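/- Let $K$ be an algebraically closed field, let $Q_A$ and $Q_B$ be finite quivers, and let $A=KQ_A/I_A$ and $B=KQ_B/I_B$ with $I_A$, $I_B$ admissible ideals (so $A$ and $B$ are finite-dimensional). Let $a$ be a vertex of $Q_A$ and $b$ a vertex of $Q_B$, let $Q$ be the quiver obtained from the disjoint union of $Q_A$ and $Q_B$ by identifying $a$ and $b$ to one vertex $v$, let $I$ be the two-sided ideal of $KQ$ generated by $I_A$ and $I_B$, and assume that the simple gluing algebra $\Lambda=KQ/I$ is finite-dimensional. Modules are left modules, and the product of paths is such that representations of a quiver are left modules over its path algebra. The inclusions of $Q_A$ and $Q_B$ in $Q$ induce (not necessarily unital) $K$-algebra homomorphisms $A\to\Lambda$ and $B\to\Lambda$; put $i_\lambda=\Lambda\otimes_A-$ and $j_\lambda=\Lambda\otimes_B-$ (that is, $\Lambda e_A\otimes_A-$ and $\Lambda e_B\otimes_B-$, where $e_A$ and $e_B$ are the images of $1_A$ and $1_B$), and let $U(v)=\Lambda e_v$, where $e_v$ is the idempotent of $v$. A module $M$ over a finite-dimensional algebra $R$ is called Gorenstein projective if $M\cong\operatorname{Ker} d^0$ for some acyclic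 complex $(P^\bullet,d^\bullet)$ of finitely generated projective $R$-modules, indexed by $\mathbb{Z}$, such that $\operatorname{Hom}_R(P^\bullet,R)$ is also acyclic. Let $X$ be a Gorenstein projective $A$-module and $Y$ a Gorenstein projective $B$-module. Then for every $f\in\operatorname{Hom}_\Lambda(i_\lambda(X),j_\lambda(Y))$ there is an integer $n\ge 0$ such that $f$ factors through $U(v)^{\oplus n}$, and for every $g\in\operatorname{Hom}_\Lambda(j_\lambda(Y),i_\lambda(X))$ there is an integer $n\ge 0$ such that $g$ factors through $U(v)^{\oplus n}$. -/

import Mathlib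

open scoped TensorProduct

noncomputable section

namespace SimpleGluing

universe u v w

/-! ### Path algebras -/

section PathAlgebra

/-- A path of a quiver, together with its source and its target. -/
structure AnyPath (V : Type u) [Quiver.{v} V] where
  src : V
  tgt : V
  path : Quiver.Path src tgt

/-- The path algebra `KQ`: the vector space with basis all paths of the quiver
(including the trivial path at each vertex). -/
def PathAlgebra (K : Type w) (V : Type u) [Field K] [Quiver.{v} V] : Type (max u v w) :=
  AnyPath V →₀ K

variable (K : Type w) (V : Type u) [Field K] [Quiver.{v} V]

instance : AddCommGroup (PathAlgebra K V) := inferInstanceAs (AddCommGroup (AnyPath V →₀ K))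

instance : Module K (PathAlgebra K V) := inferInstanceAs (Module K (AnyPath V →₀ K))

variable {V}

variable (V) in
/-- The basis of the path algebra that consists of all paths. -/
def pathBasis : Module.Basis (AnyPath V) K (PathAlgebra K V) :=
  Module.Basis.ofRepr (LinearEquiv.refl K (AnyPath V →₀ K))

/-- The basis element of the path algebra given by a path. -/
def ofPath (p : AnyPath V) : PathAlgebra K V := pathBasis K V p

/-- The idempotent of a vertex: its trivial path. -/
def vertexIdem (i : V) : PathAlgebra K V := ofPath K ⟨i, i, Quiver.Path.nil⟩

/-- The element of the path algebra given by an arrow. -/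
def ofArrow {i j : V} (α : i ⟶ j) : PathAlgebra K V := ofPath K ⟨i, j, α.toPath⟩

open Classical in
/-- The product `q * p` of two paths is "first `p`, then `q`" if the target of `p` is the source
of `q`, and `0` otherwise. With this convention representations are left modules. -/
def mulPath (q p : AnyPath V) : PathAlgebra K V :=
  if h : p.tgt = q.src then ofPath K ⟨p.src, q.tgt, (p.path.cast rfl h).comp q.path⟩ else 0

/-- The bilinear extension of the product of paths. -/
def mulLinear : PathAlgebra K V →ₗ[K] PathAlgebra K V →ₗ[K] PathAlgebra K V :=
  (pathBasis K V).constr K fun q : AnyPath V =>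
    (pathBasis K V).constr K fun p : AnyPath V => mulPath K q p

instance : Mul (PathAlgebra K V) := ⟨fun f g => mulLinear K f g⟩

instance [Fintype V] : One (PathAlgebra K V) := ⟨∑ i : V, vertexIdem K i⟩

variable {K}

theorem mul_def (f g : PathAlgebra K V) : f * g = mulLinear K f g := rfl

theorem one_def [Fintype V] : (1 : PathAlgebra K V) = ∑ i : V, vertexIdem K i := rfl

theorem ofPath_mul_ofPath (q p : AnyPath V) : ofPath K q * ofPath K p = mulPath K q p := by
  rw [mul_def, mulLinear, ofPath, ofPath, Module.Basis.constr_basis, Module.Basis.constr_basis]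

theorem induction_ofPath {P : PathAlgebra K V → Prop} (f : PathAlgebra K V) (h0 : P 0)
    (hadd : ∀ f g, P f → P g → P (f + g)) (hsmul : ∀ (c : K) (p : AnyPath V), P (c • ofPath K p)) :
    P f := by
  rw [← (pathBasis K V).linearCombination_repr f]
  induction (pathBasis K V).repr f using Finsupp.induction_linear with
  | zero => rw [map_zero]; exact h0
  | add f g hf hg => rw [map_add]; exact hadd _ _ hf hg
  | single p c => rw [Finsupp.linearCombination_single]; exact hsmul c p

theorem smul_mul' (c : K) (f g : PathAlgebra K V) : (c • f) * g = c • (f * g) := by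
  simp [mul_def]

theorem mul_smul' (c : K) (f g : PathAlgebra K V) : f * (c • g) = c • (f * g) := by
  simp [mul_def]

theorem add_mul' (f g h : PathAlgebra K V) : (f + g) * h = f * h + g * h := by
  simp [mul_def]

theorem mul_add' (f g h : PathAlgebra K V) : f * (g + h) = f * g + f * h := by
  simp [mul_def]

theorem zero_mul' (f : PathAlgebra K V) : 0 * f = 0 := by
  simp [mul_def]

theorem mul_zero' (f : PathAlgebra K V) : f * 0 = 0 := by
  simp [mul_def]

theorem mulPath_assoc (r q p : AnyPath V) :
    mulPath K r q * ofPath K p = ofPath K r * mulPath K q p := by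
  obtain ⟨a, b, p⟩ := p
  obtain ⟨c, d, q⟩ := q
  obtain ⟨e, f, r⟩ := r
  by_cases h : b = c
  · subst h
    by_cases h' : d = e
    · subst h'
      simp [mulPath, ofPath_mul_ofPath]
    · simp [mulPath, ofPath_mul_ofPath, h', zero_mul']
  · by_cases h' : d = e
    · subst h'
      simp [mulPath, ofPath_mul_ofPath, h, mul_zero']
    · simp [mulPath, h, h', zero_mul', mul_zero']

theorem mul_assoc' (f g h : PathAlgebra K V) : f * g * h = f * (g * h) := by
  induction f using induction_ofPath with
  | h0 => simp only [zero_mul']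
  | hadd f f' hf hf' => simp only [add_mul', hf, hf']
  | hsmul c r =>
    induction g using induction_ofPath with
    | h0 => simp only [zero_mul', mul_zero']
    | hadd f f' hf hf' => simp only [add_mul', mul_add', hf, hf']
    | hsmul c q =>
      induction h using induction_ofPath with
      | h0 => simp only [mul_zero']
      | hadd f f' hf hf' => simp only [mul_add', hf, hf']
      | hsmul c p =>
        simp only [smul_mul', mul_smul', ofPath_mul_ofPath, mulPath_assoc]

theorem one_mul' [Fintype V] (f : PathAlgebra K V) : 1 * f = f := by
  induction f using induction_ofPath with
  | h0 => simp only [mul_zero']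
  | hadd f f' hf hf' => simp only [mul_add', hf, hf']
  | hsmul c p =>
    obtain ⟨a, b, p⟩ := p
    rw [mul_smul', one_def, mul_def, map_sum, LinearMap.sum_apply, Finset.sum_eq_single b]
    · rw [← mul_def, vertexIdem, ofPath_mul_ofPath]
      simp [mulPath]
    · intro i _ hi
      rw [← mul_def, vertexIdem, ofPath_mul_ofPath]
      simp [mulPath, hi.symm]
    · simp

theorem mul_one' [Fintype V] (f : PathAlgebra K V) : f * 1 = f := by
  induction f using induction_ofPath with
  | h0 => simp only [zero_mul']
  | hadd f f' hf hf' => simp only [add_mul', hf, hf']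
  | hsmul c p =>
    obtain ⟨a, b, p⟩ := p
    rw [smul_mul', one_def, mul_def, map_sum, Finset.sum_eq_single a]
    · rw [← mul_def, vertexIdem, ofPath_mul_ofPath]
      simp [mulPath]
    · intro i _ hi
      rw [← mul_def, vertexIdem, ofPath_mul_ofPath]
      simp [mulPath, hi]
    · simp

instance [Fintype V] : Ring (PathAlgebra K V) :=
  { (inferInstance : AddCommGroup (PathAlgebra K V)) with
    mul := (· * ·)
    one := 1
    left_distrib := mul_add'
    right_distrib := add_mul'
    zero_mul := zero_mul'
    mul_zero := mul_zero'
    mul_assoc := mul_assoc'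
    one_mul := one_mul'
    mul_one := mul_one' }

instance [Fintype V] : Algebra K (PathAlgebra K V) :=
  Algebra.ofModule smul_mul' mul_smul'

variable (K V)

/-- The arrow ideal `R_Q`: the two-sided ideal generated by all arrows. -/
def arrowIdeal [Fintype V] : TwoSidedIdeal (PathAlgebra K V) :=
  TwoSidedIdeal.span {x | ∃ (i j : V) (α : i ⟶ j), x = ofArrow K α}

variable {K V}

/-- A two-sided ideal as a `K`-subspace. -/
def toSubspace [Fintype V] (I : TwoSidedIdeal (PathAlgebra K V)) : Submodule K (PathAlgebra K V) :=
  (TwoSidedIdeal.asIdeal I).restrictScalars K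

/-- Admissible ideals: `R_Q ^ m ⊆ I ⊆ R_Q ^ 2` for some `m ≥ 2`. -/
def IsAdmissible [Fintype V] (I : TwoSidedIdeal (PathAlgebra K V)) : Prop :=
  ∃ m : ℕ, 2 ≤ m ∧ toSubspace (arrowIdeal K V) ^ m ≤ toSubspace I ∧
    toSubspace I ≤ toSubspace (arrowIdeal K V) ^ 2

/-- The algebra `KQ/I`. -/
abbrev QuotAlg [Fintype V] (I : TwoSidedIdeal (PathAlgebra K V)) : Type (max u v w) :=
  I.ringCon.Quotient

/-- The class in `KQ/I` of an element of the path algebra. -/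
def quotMk [Fintype V] (I : TwoSidedIdeal (PathAlgebra K V)) (x : PathAlgebra K V) : QuotAlg I :=
  (x : I.ringCon.Quotient)

/-- The indecomposable projective left module `(KQ/I) e_i` of a vertex `i`. -/
abbrev vertexProj [Fintype V] (I : TwoSidedIdeal (PathAlgebra K V)) (i : V) :
    Submodule (QuotAlg I) (QuotAlg I) :=
  Submodule.span (QuotAlg I) {quotMk I (vertexIdem K i)}

end PathAlgebra

/-! ### Maps of path algebras along an embedding of quivers -/

section Map

variable (K : Type w) [Field K] {V : Type*} {W : Type*} [Quiver V] [Quiver W]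

/-- The image of a path under a morphism of quivers. -/
def AnyPath.map (F : V ⥤q W) (p : AnyPath V) : AnyPath W :=
  ⟨F.obj p.src, F.obj p.tgt, F.mapPath p.path⟩

/-- The linear map of path algebras that sends each path to its image. -/
def pathMap (F : V ⥤q W) : PathAlgebra K V →ₗ[K] PathAlgebra K W :=
  (pathBasis K V).constr K fun p => ofPath K (p.map F)

variable {K}

theorem pathMap_ofPath (F : V ⥤q W) (p : AnyPath V) :
    pathMap K F (ofPath K p) = ofPath K (p.map F) := by
  rw [pathMap, ofPath, Module.Basis.constr_basis]

theorem pathMap_mul (F : V ⥤q W) (hF : Function.Injective F.obj) (f g : PathAlgebra K V) :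
    pathMap K F (f * g) = pathMap K F f * pathMap K F g := by
  induction f using induction_ofPath with
  | h0 => simp only [zero_mul', map_zero]
  | hadd f f' hf hf' => simp only [add_mul', map_add, hf, hf']
  | hsmul c q =>
    induction g using induction_ofPath with
    | h0 => simp only [mul_zero', map_zero]
    | hadd f f' hf hf' => simp only [mul_add', map_add, hf, hf']
    | hsmul c p =>
      simp only [smul_mul', mul_smul', map_smul, pathMap_ofPath, ofPath_mul_ofPath]
      obtain ⟨a, b, p⟩ := p
      obtain ⟨c, d, q⟩ := q
      by_cases h : b = c
      · subst h
        simp [mulPath, AnyPath.map, pathMap_ofPath]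
      · have h' : F.obj b ≠ F.obj c := fun e => h (hF e)
        simp [mulPath, AnyPath.map, h, h']

/-- The algebra map `KQ/I → KQ'/I'` induced by an embedding of quivers that sends `I` into `I'`.
It need not preserve the unit: the unit goes to the sum of the idempotents of the vertices in the
image. -/
def quotMap [Fintype V] [Fintype W] (F : V ⥤q W) (hF : Function.Injective F.obj)
    (I : TwoSidedIdeal (PathAlgebra K V)) (J : TwoSidedIdeal (PathAlgebra K W))
    (h : ∀ x ∈ I, pathMap K F x ∈ J) : QuotAlg I →ₙₐ[K] QuotAlg J where
  toFun := Quotient.lift (fun x => quotMk J (pathMap K F x)) (by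
    intro x y hxy
    refine Quotient.sound ?_
    have h1 : x - y ∈ I := (TwoSidedIdeal.rel_iff I x y).1 hxy
    refine (TwoSidedIdeal.rel_iff J _ _).2 ?_
    rw [← map_sub]
    exact h _ h1)
  map_smul' c x := by
    induction x using Quotient.inductionOn with
    | h x => exact congrArg (quotMk J) (map_smul (pathMap K F) c x)
  map_zero' := congrArg (quotMk J) (map_zero (pathMap K F))
  map_add' x y := by
    induction x using Quotient.inductionOn with
    | h x =>
      induction y using Quotient.inductionOn with
      | h y => exact congrArg (quotMk J) (map_add (pathMap K F) x y)
  map_mul' x y := by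
    induction x using Quotient.inductionOn with
    | h x =>
      induction y using Quotient.inductionOn with
      | h y => exact congrArg (quotMk J) (pathMap_mul F hF x y)

theorem quotMap_quotMk [Fintype V] [Fintype W] (F : V ⥤q W) (hF : Function.Injective F.obj)
    (I : TwoSidedIdeal (PathAlgebra K V)) (J : TwoSidedIdeal (PathAlgebra K W))
    (h : ∀ x ∈ I, pathMap K F x ∈ J) (x : PathAlgebra K V) :
    quotMap F hF I J h (quotMk I x) = quotMk J (pathMap K F x) := rfl

end Map

/-! ### The simple gluing quiver and the simple gluing algebra -/

section Gluing

variable {VA : Type*} {VB : Type*}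

/-- The relation on the disjoint union of the vertex sets that identifies `a` with `b`. -/
def GlueRel (a : VA) (b : VB) (x y : VA ⊕ VB) : Prop := x = Sum.inl a ∧ y = Sum.inr b

/-- The vertex set of the glued quiver: the disjoint union, with `a` and `b` identified. -/
def GlueVertex (a : VA) (b : VB) := Quot (GlueRel a b)

variable (a : VA) (b : VB)

/-- The inclusion of the vertices of the first quiver. -/
def GlueVertex.inA (i : VA) : GlueVertex a b := Quot.mk _ (Sum.inl i)

/-- The inclusion of the vertices of the second quiver. -/
def GlueVertex.inB (j : VB) : GlueVertex a b := Quot.mk _ (Sum.inr j)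

/-- The glued vertex `v`. -/
def GlueVertex.glued : GlueVertex a b := GlueVertex.inA a b a

theorem GlueVertex.inA_eq_inB : GlueVertex.inA a b a = GlueVertex.inB a b b :=
  Quot.sound ⟨rfl, rfl⟩

theorem GlueVertex.inA_injective : Function.Injective (GlueVertex.inA a b) := by
  classical
  intro i j h
  let f : GlueVertex a b → VA ⊕ VB :=
    Quot.lift (Sum.elim Sum.inl fun j => if j = b then Sum.inl a else Sum.inr j) (by
      rintro _ _ ⟨rfl, rfl⟩
      simp)
  exact Sum.inl_injective (congrArg f h)

theorem GlueVertex.inB_injective : Function.Injective (GlueVertex.inB a b) := by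
  classical
  intro i j h
  let f : GlueVertex a b → VA ⊕ VB :=
    Quot.lift (Sum.elim (fun i => if i = a then Sum.inr b else Sum.inl i) Sum.inr) (by
      rintro _ _ ⟨rfl, rfl⟩
      simp)
  exact Sum.inr_injective (congrArg f h)

instance [Finite VA] [Finite VB] : Fintype (GlueVertex a b) :=
  have : Finite (GlueVertex a b) := inferInstanceAs (Finite (Quot (GlueRel a b)))
  Fintype.ofFinite _

/-- The arrows of the glued quiver: those of the first quiver and those of the second one. -/
inductive GlueHom [Quiver VA] [Quiver VB] (a : VA) (b : VB) : GlueVertex a b → GlueVertex a b → Type _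
  | left {i j : VA} (α : i ⟶ j) : GlueHom a b (GlueVertex.inA a b i) (GlueVertex.inA a b j)
  | right {i j : VB} (β : i ⟶ j) : GlueHom a b (GlueVertex.inB a b i) (GlueVertex.inB a b j)

variable [Quiver VA] [Quiver VB]

/-- The simple gluing quiver. -/
instance : Quiver (GlueVertex a b) := ⟨GlueHom a b⟩

/-- The inclusion of the first quiver in the glued quiver. -/
def inclA : VA ⥤q GlueVertex a b where
  obj := GlueVertex.inA a b
  map α := GlueHom.left α

/-- The inclusion of the second quiver in the glued quiver. -/
def inclB : VB ⥤q GlueVertex a b where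
  obj := GlueVertex.inB a b
  map β := GlueHom.right β

variable {K : Type*} [Field K] [Fintype VA] [Fintype VB]

/-- The ideal of the path algebra of the glued quiver generated by `I_A` and `I_B`. -/
def glueIdeal (IA : TwoSidedIdeal (PathAlgebra K VA)) (IB : TwoSidedIdeal (PathAlgebra K VB)) :
    TwoSidedIdeal (PathAlgebra K (GlueVertex a b)) :=
  TwoSidedIdeal.span
    (pathMap K (inclA a b) '' {x | x ∈ IA} ∪ pathMap K (inclB a b) '' {x | x ∈ IB})

variable (IA : TwoSidedIdeal (PathAlgebra K VA)) (IB : TwoSidedIdeal (PathAlgebra K VB))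

/-- The algebra `Λ = KQ/I` of the glued quiver. -/
abbrev GlueAlg := QuotAlg (glueIdeal a b IA IB)

/-- The canonical map `A → Λ`. -/
def mapA : QuotAlg IA →ₙₐ[K] GlueAlg a b IA IB :=
  quotMap (inclA a b) (GlueVertex.inA_injective a b) IA (glueIdeal a b IA IB) fun x hx =>
    TwoSidedIdeal.subset_span (Or.inl ⟨x, hx, rfl⟩)

/-- The canonical map `B → Λ`. -/
def mapB : QuotAlg IB →ₙₐ[K] GlueAlg a b IA IB :=
  quotMap (inclB a b) (GlueVertex.inB_injective a b) IB (glueIdeal a b IA IB) fun x hx =>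
    TwoSidedIdeal.subset_span (Or.inr ⟨x, hx, rfl⟩)

/-- The projective `Λ`-module `U(v) = Λ e_v` of the glued vertex. -/
abbrev gluedProj : Submodule (GlueAlg a b IA IB) (GlueAlg a b IA IB) :=
  vertexProj (glueIdeal a b IA IB) (GlueVertex.glued a b)

end Gluing

/-! ### Induced modules -/

section Induced

variable {K R S : Type*} [Field K] [Ring R] [Algebra K R] [Ring S] [Algebra K S]
variable (φ : R →ₙₐ[K] S) (M : Type*) [AddCommGroup M] [Module K M] [Module R M]

/-- The relations `(s φ(r)) ⊗ m = s ⊗ (r m)`. -/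
def inducedRel : Submodule S (S ⊗[K] M) :=
  Submodule.span S {z | ∃ (s : S) (r : R) (m : M), z = (s * φ r) ⊗ₜ[K] m - s ⊗ₜ[K] (r • m)}

/-- The left `S`-module `S ⊗_R M`, where `R` acts on `S` from the right through `φ : R → S`.
If `φ` is not unital, then `s ⊗ m = s φ(1) ⊗ m` holds in it, so that it is
`S φ(1) ⊗_R M`. -/
abbrev Induced := (S ⊗[K] M) ⧸ inducedRel φ M

end Induced

/-! ### Gorenstein projective modules -/

section Gorenstein

open CategoryTheory

variable {R : Type u} [Ring R]

/-- Totally acyclic complexes of finitely generated projective modules: `P` is acyclic, and so is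
`Hom_R(P, R)`, that is, a homomorphism `P^{n+1} → R` that vanishes on the image of `d^n`
factors through `d^{n+1}`. -/
structure IsTotallyAcyclic (P : CochainComplex (ModuleCat.{u} R) ℤ) : Prop where
  finite : ∀ n, Module.Finite R (P.X n)
  projective : ∀ n, Module.Projective R (P.X n)
  acyclic : P.Acyclic
  hom_acyclic : ∀ (n : ℤ) (g : P.X (n + 1) ⟶ ModuleCat.of R R), P.d n (n + 1) ≫ g = 0 →
    ∃ h : P.X (n + 1 + 1) ⟶ ModuleCat.of R R, g = P.d (n + 1) (n + 1 + 1) ≫ h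

variable (R) in
/-- A module is (finitely generated) Gorenstein projective if it is isomorphic to `Ker d^0` for a
totally acyclic complex of finitely generated projective modules. -/
def IsGorensteinProjective (M : Type*) [AddCommGroup M] [Module R M] : Prop :=
  ∃ P : CochainComplex (ModuleCat.{u} R) ℤ, IsTotallyAcyclic P ∧
    Nonempty (M ≃ₗ[R] LinearMap.ker (P.d 0 1).hom)

end Gorenstein

/-- A homomorphism factors through a finite direct sum of copies of `U`. -/
def FactorsThroughCopies {R M N : Type*} (U : Type*) [Ring R] [AddCommGroup M] [Module R M]
    [AddCommGroup N] [Module R N] [AddCommGroup U] [Module R U] (f : M →ₗ[R] N) : Prop :=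
  ∃ (n : ℕ) (g : M →ₗ[R] (Fin n → U)) (h : (Fin n → U) →ₗ[R] N), f = h ∘ₗ g

end SimpleGluing

end

/-! Write e for e_v, so that e = e_A e_B = e_B e_A, and μ for the multiplication Λ ⊗_K Λ → Λ. The
bimodules e_A Λ e_B and e_B Λ e_A are direct summands of e_A(Λe ⊗_K Λ)e_B and e_B(Λe ⊗_K Λ)e_A, with
retraction μ.

The splittings come from one derivation D : Λ → Λe ⊗_K Λ, zero on A and equal to y ↦ y(e ⊗ e) − (e ⊗
e)y on B. It exists because a derivation of KQ that kills the e_i may be prescribed on arrows, and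
every arrow of Q lies on exactly one side. It kills the generators of I, hence I, by the Leibniz
rule. Moreover μ(D x) = x e_A − e_A x (`mul'_glueDer`). Then x ↦ x(e ⊗ e) − D x is left A-linear and
right B-linear, x ↦ D x + (e ⊗ e)x is left B-linear and right A-linear, and both split μ between the
two units (`factorsThroughCopies_of_derivation`).

Tensoring the first splitting with Y embeds e_A j_λ(Y), A-linearly, in Λe ⊗_K j_λ(Y), with the
action of Λ as retraction. A map i_λ(X) → j_λ(Y) is an A-linear map X → e_A j_λ(Y), so it factors
through Λe ⊗_K j_λ(Y), a direct sum of copies of Λe (`factorsThroughCopies_of_section`). Finite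
generation of X, which Gorenstein projectivity supplies, leaves finitely many copies
(`factorsThroughCopies_of_tensor`). The other direction is the same with the second splitting. -/

open scoped TensorProduct

noncomputable section

namespace SimpleGluing

/-! ### Modules induced along a non-unital algebra map -/

section Section

variable {K R S : Type*} [Field K] [Ring R] [Algebra K R] [Ring S] [Algebra K S]
variable (φ : R →ₙₐ[K] S) {M : Type*} [AddCommGroup M] [Module K M] [Module R M]

variable (M) in
/-- The class of `s ⊗ m` in the induced module, as a bilinear map. -/
def inducedMk : S →ₗ[K] M →ₗ[K] Induced φ M :=
  LinearMap.compr₂ (TensorProduct.mk K S M) ((inducedRel φ M).mkQ.restrictScalars K)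

theorem smul_inducedMk (t s : S) (m : M) :
    t • inducedMk φ M s m = inducedMk φ M (t * s) m := rfl

theorem inducedMk_mul (s : S) (r : R) (m : M) :
    inducedMk φ M (s * φ r) m = inducedMk φ M s (r • m) := by
  refine (Submodule.Quotient.eq _).2 ?_
  exact Submodule.subset_span ⟨s, r, m, rfl⟩

theorem inducedMk_mul_one (s : S) (m : M) :
    inducedMk φ M (s * φ 1) m = inducedMk φ M s m := by
  rw [inducedMk_mul, one_smul]

theorem induced_induction {P : Induced φ M → Prop} (z : Induced φ M)
    (h0 : P 0) (hadd : ∀ x y, P x → P y → P (x + y)) (hmk : ∀ s m, P (inducedMk φ M s m)) :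
    P z := by
  obtain ⟨z, rfl⟩ := Submodule.mkQ_surjective _ z
  induction z using TensorProduct.induction_on with
  | zero => rw [map_zero]; exact h0
  | tmul s m => exact hmk s m
  | add x y hx hy => rw [map_add]; exact hadd _ _ hx hy

/-- A balanced bilinear map on `S × M` induces a linear map on the induced module. -/
def inducedLift {N : Type*} [AddCommGroup N] [Module K N] (F : S →ₗ[K] M →ₗ[K] N)
    (hF : ∀ s r m, F (s * φ r) m = F s (r • m)) : Induced φ M →ₗ[K] N where
  __ := QuotientAddGroup.lift (inducedRel φ M).toAddSubgroup
    (TensorProduct.lift F).toAddMonoidHom (by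
      intro z hz
      -- The relations span an S-submodule, but F is only K-linear; quantifying over t makes the
      -- claim stable under S.
      have key : ∀ t : S, TensorProduct.lift F (t • z) = 0 := by
        change z ∈ inducedRel φ M at hz
        induction hz using Submodule.span_induction with
        | mem z hz =>
          obtain ⟨s, r, m, rfl⟩ := hz
          intro t
          rw [smul_sub, TensorProduct.smul_tmul', TensorProduct.smul_tmul', map_sub,
            TensorProduct.lift.tmul, TensorProduct.lift.tmul, smul_eq_mul, smul_eq_mul,
            ← mul_assoc, hF, sub_self]
        | zero => intro t; rw [smul_zero, map_zero]
        | add x y _ _ hx hy => intro t; rw [smul_add, map_add, hx, hy, add_zero]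
        | smul u x _ hx => intro t; rw [smul_smul, hx]
      have := key 1
      rwa [one_smul] at this)
  map_smul' c z := by
    obtain ⟨z, rfl⟩ := Submodule.mkQ_surjective _ z
    exact map_smul (TensorProduct.lift F) c z

theorem inducedLift_mk {N : Type*} [AddCommGroup N] [Module K N] (F : S →ₗ[K] M →ₗ[K] N)
    (hF : ∀ s r m, F (s * φ r) m = F s (r • m)) (s : S) (m : M) :
    inducedLift φ F hF (inducedMk φ M s m) = F s m := by
  change TensorProduct.lift F (s ⊗ₜ m) = _
  rw [TensorProduct.lift.tmul]

variable (S) in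
/-- The bilinear map `(s, m) ↦ s u(m)`. -/
def smulBilin {N : Type*} [AddCommGroup N] [Module K N] [Module S N] [IsScalarTower K S N]
    (u : M →ₗ[K] N) : S →ₗ[K] M →ₗ[K] N :=
  (Algebra.lsmul K K N : S →ₐ[K] Module.End K N).toLinearMap.compl₂ u

theorem smulBilin_apply {N : Type*} [AddCommGroup N] [Module K N] [Module S N]
    [IsScalarTower K S N] (u : M →ₗ[K] N) (s : S) (m : M) : smulBilin S u s m = s • u m := rfl

theorem smulBilin_mul {N : Type*} [AddCommGroup N] [Module K N] [Module S N]
    [IsScalarTower K S N] (u : M →ₗ[K] N) (hu : ∀ r m, u (r • m) = φ r • u m) (s : S) (r : R)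
    (m : M) : smulBilin S u (s * φ r) m = smulBilin S u s (r • m) := by
  rw [smulBilin_apply, smulBilin_apply, hu, smul_smul]

/-- A semilinear map out of `M` induces a linear map out of the induced module. -/
def inducedDesc {N : Type*} [AddCommGroup N] [Module K N] [Module S N] [IsScalarTower K S N]
    (u : M →ₗ[K] N) (hu : ∀ r m, u (r • m) = φ r • u m) : Induced φ M →ₗ[S] N where
  __ := inducedLift φ (smulBilin S u) (smulBilin_mul φ u hu)
  map_smul' t z := by
    simp only [AddHom.toFun_eq_coe, LinearMap.coe_toAddHom, RingHom.id_apply]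
    induction z using induced_induction with
    | h0 => simp
    | hadd x y hx hy => simp only [smul_add, map_add, hx, hy]
    | hmk s m =>
      rw [smul_inducedMk, inducedLift_mk, inducedLift_mk, smulBilin_apply, smulBilin_apply,
        smul_smul]

theorem inducedDesc_mk {N : Type*} [AddCommGroup N] [Module K N] [Module S N]
    [IsScalarTower K S N] (u : M →ₗ[K] N) (hu : ∀ r m, u (r • m) = φ r • u m) (s : S) (m : M) :
    inducedDesc φ u hu (inducedMk φ M s m) = s • u m :=
  inducedLift_mk φ (smulBilin S u) (smulBilin_mul φ u hu) s m

theorem induced_hom_ext {N : Type*} [AddCommGroup N] [Module S N] (f g : Induced φ M →ₗ[S] N)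
    (h : ∀ m, f (inducedMk φ M 1 m) = g (inducedMk φ M 1 m)) : f = g := by
  refine LinearMap.ext fun z => ?_
  induction z using induced_induction with
  | h0 => simp
  | hadd x y hx hy => rw [map_add, map_add, hx, hy]
  | hmk s m =>
    rw [← mul_one s, ← smul_inducedMk, map_smul, map_smul, h]

theorem smul_inducedMk_one (r : R) (m : M) :
    φ r • inducedMk φ M 1 m = inducedMk φ M 1 (r • m) := by
  rw [smul_inducedMk, mul_one, ← inducedMk_mul, one_mul]

theorem finite_induced [Module.Finite R M] : Module.Finite S (Induced φ M) := by
  classical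
  obtain ⟨t, ht⟩ := Module.Finite.fg_top (R := R) (M := M)
  refine ⟨t.image (inducedMk φ M 1), ?_⟩
  rw [eq_top_iff]
  have key : ∀ m : M, inducedMk φ M 1 m ∈
      Submodule.span S ((t.image (inducedMk φ M 1) : Finset _) : Set (Induced φ M)) := by
    intro m
    have hm : m ∈ Submodule.span R (t : Set M) := by rw [ht]; trivial
    induction hm using Submodule.span_induction with
    | mem m hm => exact Submodule.subset_span (Finset.mem_coe.2 (Finset.mem_image_of_mem _ hm))
    | zero => rw [map_zero]; exact zero_mem _
    | add x y _ _ hx hy => rw [map_add]; exact add_mem hx hy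
    | smul r x _ hx => rw [← smul_inducedMk_one]; exact Submodule.smul_mem _ _ hx
  rintro z -
  induction z using induced_induction with
  | h0 => exact zero_mem _
  | hadd x y hx hy => exact add_mem hx hy
  | hmk s m =>
    rw [← mul_one s, ← smul_inducedMk]
    exact Submodule.smul_mem _ _ (key m)

/-- The action map `S ⊗ N → N`. -/
def tensorAction (K S N : Type*) [Field K] [Ring S] [Algebra K S] [AddCommGroup N] [Module K N]
    [Module S N] [IsScalarTower K S N] : S ⊗[K] N →ₗ[S] N where
  __ := TensorProduct.lift (Algebra.lsmul K K N : S →ₐ[K] Module.End K N).toLinearMap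
  map_smul' t z := by
    simp only [AddHom.toFun_eq_coe, LinearMap.coe_toAddHom, RingHom.id_apply]
    induction z using TensorProduct.induction_on with
    | zero => simp
    | tmul s n => simp [TensorProduct.smul_tmul']
    | add x y hx hy => rw [smul_add, map_add, map_add, hx, hy, smul_add]

theorem tensorAction_tmul {N : Type*} [AddCommGroup N] [Module K N] [Module S N]
    [IsScalarTower K S N] (s : S) (n : N) : tensorAction K S N (s ⊗ₜ n) = s • n := rfl

theorem rTensor_mulRight_smul {N : Type*} [AddCommGroup N] [Module K N] (e t : S) (z : S ⊗[K] N) :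
    (LinearMap.mulRight K e).rTensor N (t • z) = t • (LinearMap.mulRight K e).rTensor N z := by
  induction z using TensorProduct.induction_on with
  | zero => simp
  | tmul s n => simp [TensorProduct.smul_tmul', mul_assoc]
  | add x y hx hy => rw [smul_add, map_add, map_add, hx, hy, smul_add]

theorem repr_baseChange_rTensor_mulRight {N ι : Type*} [AddCommGroup N] [Module K N]
    (b : Module.Basis ι K N) (e : S) (z : S ⊗[K] N) (i : ι) :
    (b.baseChange S).repr ((LinearMap.mulRight K e).rTensor N z) i =
      (b.baseChange S).repr z i * e := by
  induction z using TensorProduct.induction_on with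
  | zero => simp
  | tmul s n => simp
  | add x y hx hy => simp only [map_add, Finsupp.add_apply, hx, hy, add_mul]

/-- A homomorphism from a finitely generated module that factors through `S e ⊗ N` for some
vector space `N` factors through finitely many copies of `S e`. -/
theorem factorsThroughCopies_of_tensor {L N N' : Type*} [AddCommGroup L] [Module S L]
    [Module.Finite S L] [AddCommGroup N] [Module K N] [AddCommGroup N'] [Module S N']
    (e : S) (h : L →ₗ[S] S ⊗[K] N)
    (he : ∀ l, (LinearMap.mulRight K e).rTensor N (h l) = h l)
    (f : S ⊗[K] N →ₗ[S] N') :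
    FactorsThroughCopies (Submodule.span S {e}) (f ∘ₗ h) := by
  classical
  let b := (Module.Basis.ofVectorSpace K N).baseChange S
  obtain ⟨t, ht⟩ := Module.Finite.fg_top (R := S) (M := L)
  -- S ⊗ N is free over S on a K-basis of N. The finitely many generators of L involve finitely many
  -- basis vectors, and these index the copies of S e.
  let J := t.biUnion fun l => (b.repr (h l)).support
  have hJ : ∀ l, b.repr (h l) ∈ Finsupp.supported S S (J : Set _) := by
    intro l
    have hl : l ∈ Submodule.span S (t : Set L) := by rw [ht]; trivial
    induction hl using Submodule.span_induction with
    | mem l hl =>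
      rw [Finsupp.mem_supported]
      exact Finset.coe_subset.2 (Finset.subset_biUnion_of_mem (fun l => (b.repr (h l)).support) hl)
    | zero => rw [map_zero, map_zero]; exact zero_mem _
    | add x y _ _ hx hy => rw [map_add, map_add]; exact add_mem hx hy
    | smul c x _ hx => rw [map_smul, map_smul]; exact Submodule.smul_mem _ _ hx
  have hmem : ∀ i l, b.repr (h l) i ∈ Submodule.span S {e} := by
    intro i l
    rw [← he l, repr_baseChange_rTensor_mulRight]
    exact Submodule.smul_mem _ _ (Submodule.mem_span_singleton_self e)
  let ε := J.equivFin
  refine ⟨J.card,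
    LinearMap.pi fun k => (b.coord (ε.symm k) ∘ₗ h).codRestrict _ fun l => hmem _ l,
    ∑ k, (LinearMap.toSpanSingleton S N' (f (b (ε.symm k))) ∘ₗ (Submodule.span S {e}).subtype) ∘ₗ
      LinearMap.proj k, LinearMap.ext fun l => ?_⟩
  have h1 : h l = ∑ i ∈ J, b.repr (h l) i • b i := by
    conv_lhs => rw [← b.linearCombination_repr (h l)]
    exact Finsupp.sum_of_support_subset _ ((Finsupp.mem_supported _ _).1 (hJ l)) _ (by simp)
  have h2 : f (h l) = ∑ k, b.repr (h l) (ε.symm k) • f (b (ε.symm k)) := by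
    rw [ε.symm.sum_comp (fun i : J => b.repr (h l) i • f (b i))]
    conv_lhs => rw [h1]
    rw [map_sum, ← Finset.sum_coe_sort]
    simp only [map_smul]
  rw [LinearMap.comp_apply, h2, LinearMap.comp_apply, LinearMap.sum_apply]
  rfl

end Section

/-! ### From a bimodule splitting to a factorization -/

section Bimodule

variable {K R R' S : Type*} [Field K] [Ring R] [Algebra K R] [Ring R'] [Algebra K R']
  [Ring S] [Algebra K S]
variable (φ : R →ₙₐ[K] S) (ψ : R' →ₙₐ[K] S) (M : Type*) [AddCommGroup M] [Module K M] [Module R M]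

theorem lTensor_inducedMk_mul (r : R) (m : M) (t : S ⊗[K] S) :
    ((inducedMk φ M).flip m).lTensor S (t * (1 ⊗ₜ φ r)) =
      ((inducedMk φ M).flip (r • m)).lTensor S t := by
  induction t using TensorProduct.induction_on with
  | zero => simp
  | tmul u w => simp [inducedMk_mul]
  | add x y hx hy => rw [add_mul, map_add, map_add, hx, hy]

theorem lTensor_smul {N : Type*} [AddCommGroup N] [Module K N] (F : S →ₗ[K] N) (s : S)
    (t : S ⊗[K] S) : F.lTensor S ((s ⊗ₜ 1) * t) = s • F.lTensor S t := by
  induction t using TensorProduct.induction_on with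
  | zero => simp
  | tmul u w => simp [TensorProduct.smul_tmul']
  | add x y hx hy => rw [mul_add, map_add, map_add, hx, hy, smul_add]

theorem rTensor_lTensor_mulRight {N : Type*} [AddCommGroup N] [Module K N] (F : S →ₗ[K] N) (e : S)
    (t : S ⊗[K] S) : (LinearMap.mulRight K e).rTensor N (F.lTensor S t) =
      F.lTensor S (t * (e ⊗ₜ 1)) := by
  induction t using TensorProduct.induction_on with
  | zero => simp
  | tmul u w => simp
  | add x y hx hy => rw [add_mul, map_add, map_add, map_add, hx, hy]

theorem tensorAction_lTensor_inducedMk (m : M) (t : S ⊗[K] S) :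
    tensorAction K S (Induced φ M) (((inducedMk φ M).flip m).lTensor S t) =
      inducedMk φ M (LinearMap.mul' K S t) m := by
  induction t using TensorProduct.induction_on with
  | zero => simp
  | tmul u w => simp [tensorAction_tmul, smul_inducedMk]
  | add x y hx hy => rw [map_add, map_add, map_add, map_add, hx, hy, LinearMap.add_apply]

/-- If `ψ(1) S φ(1)` is a direct summand of `S e ⊗ S` as a bimodule, then homomorphisms from modules
induced along `ψ` to modules induced along `φ` factor through copies of `S e`. -/
theorem factorsThroughCopies_of_section {L : Type*} [AddCommGroup L] [Module K L] [Module R' L]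
    [Module.Finite R' L] (e : S) (s : S →ₗ[K] S ⊗[K] S)
    (hψ : ∀ b x, s (ψ b * x) = (ψ b ⊗ₜ 1) * s x)
    (hφ : ∀ a x, s (x * φ a) = s x * (1 ⊗ₜ φ a))
    (he : ∀ x, s x * (e ⊗ₜ 1) = s x)
    (hs : ∀ x, ψ 1 * LinearMap.mul' K S (s x) * φ 1 = ψ 1 * x * φ 1)
    (g : Induced ψ L →ₗ[S] Induced φ M) :
    FactorsThroughCopies (Submodule.span S {e}) g := by
  have := finite_induced (K := K) ψ (M := L)
  -- This is s ⊗_R M: balanced by right R-linearity of s, and compatible with the action of R' by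
  -- left linearity.
  let σ : Induced φ M →ₗ[K] S ⊗[K] Induced φ M :=
    inducedLift φ ((LinearMap.lTensorHom S ∘ₗ (inducedMk φ M).flip).flip ∘ₗ s) (by
      intro x r m
      change ((inducedMk φ M).flip m).lTensor S (s (x * φ r)) =
        ((inducedMk φ M).flip (r • m)).lTensor S (s x)
      rw [hφ, lTensor_inducedMk_mul])
  have hσ : ∀ x m, σ (inducedMk φ M x m) = ((inducedMk φ M).flip m).lTensor S (s x) :=
    fun x m => inducedLift_mk φ _ _ x m
  have hσ_smul : ∀ b z, σ (ψ b • z) = ψ b • σ z := by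
    intro b z
    induction z using induced_induction with
    | h0 => simp
    | hadd x y hx hy => rw [smul_add, map_add, map_add, hx, hy, smul_add]
    | hmk x m => rw [smul_inducedMk, hσ, hσ, hψ, lTensor_smul]
  have hσ_e : ∀ z, (LinearMap.mulRight K e).rTensor _ (σ z) = σ z := by
    intro z
    induction z using induced_induction with
    | h0 => simp
    | hadd x y hx hy => rw [map_add, map_add, hx, hy]
    | hmk x m => rw [hσ, rTensor_lTensor_mulRight, he]
  have hσ_act : ∀ z, ψ 1 • tensorAction K S _ (σ z) = ψ 1 • z := by
    intro z
    induction z using induced_induction with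
    | h0 => simp
    | hadd x y hx hy => rw [map_add, map_add, smul_add, hx, hy, smul_add]
    | hmk x m =>
      -- In the induced module a right factor φ(1) can be inserted or removed freely, so splitting
      -- between ψ(1) and φ(1) is enough.
      rw [hσ, tensorAction_lTensor_inducedMk, smul_inducedMk, smul_inducedMk,
        ← inducedMk_mul_one φ (ψ 1 * x), ← hs, inducedMk_mul_one]
  -- σ ∘ g is linear over R' but not over S; h is the S-linear extension of its restriction to L.
  let h : Induced ψ L →ₗ[S] S ⊗[K] Induced φ M :=
    inducedDesc ψ (σ ∘ₗ g.restrictScalars K ∘ₗ inducedMk ψ L 1) (by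
      intro r l
      change σ (g _) = ψ r • σ (g _)
      rw [← smul_inducedMk_one, map_smul, hσ_smul])
  have hh : ∀ x l, h (inducedMk ψ L x l) = x • σ (g (inducedMk ψ L 1 l)) :=
    fun x l => inducedDesc_mk ψ _ _ x l
  have key : g = tensorAction K S _ ∘ₗ h := by
    refine induced_hom_ext ψ _ _ fun l => ?_
    have hl : g (inducedMk ψ L 1 l) = ψ 1 • g (inducedMk ψ L 1 l) := by
      rw [← map_smul, smul_inducedMk_one, one_smul]
    rw [LinearMap.comp_apply, hh, one_smul, hl, hσ_smul, map_smul, hσ_act]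
  rw [key]
  refine factorsThroughCopies_of_tensor e h (fun z => ?_) _
  induction z using induced_induction with
  | h0 => simp
  | hadd x y hx hy => rw [map_add, map_add, hx, hy]
  | hmk x l => rw [hh, rTensor_mulRight_smul, hσ_e]

end Bimodule

/-! ### Finite generation of Gorenstein projective modules -/

section Gorenstein

open CategoryTheory

universe u

/-- By acyclicity Ker d^0 is the image of d^{-1}, a quotient of the finitely generated module
P^{-1}. -/
theorem IsGorensteinProjective.finite {R : Type u} [Ring R] {M : Type*} [AddCommGroup M]
    [Module R M] (h : IsGorensteinProjective R M) : Module.Finite R M := by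
  obtain ⟨P, hP, ⟨ε⟩⟩ := h
  have := hP.finite (-1)
  have hex := hP.acyclic 0
  rw [HomologicalComplex.exactAt_iff' P (-1) 0 1 (by simp) (by simp),
    ShortComplex.moduleCat_exact_iff_range_eq_ker] at hex
  have hr : LinearMap.range (P.d (-1) 0).hom = LinearMap.ker (P.d 0 1).hom := hex
  have : Module.Finite R (LinearMap.ker (P.d 0 1).hom) := by
    rw [← hr]
    infer_instance
  exact Module.Finite.equiv ε.symm

end Gorenstein

/-! ### From a derivation to the two bimodule splittings -/

section TensorDerivation

variable {K R R' S : Type*} [Field K] [Ring R] [Algebra K R] [Ring R'] [Algebra K R']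
  [Ring S] [Algebra K S]

theorem mul'_left (x : S) (t : S ⊗[K] S) :
    LinearMap.mul' K S ((x ⊗ₜ 1) * t) = x * LinearMap.mul' K S t := by
  induction t using TensorProduct.induction_on with
  | zero => simp
  | tmul u w => simp [mul_assoc]
  | add x y hx hy => rw [mul_add, map_add, map_add, hx, hy, mul_add]

theorem mul'_right (x : S) (t : S ⊗[K] S) :
    LinearMap.mul' K S (t * (1 ⊗ₜ x)) = LinearMap.mul' K S t * x := by
  induction t using TensorProduct.induction_on with
  | zero => simp
  | tmul u w => simp [mul_assoc]
  | add x y hx hy => rw [add_mul, map_add, map_add, hx, hy, add_mul]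

/-- A derivation `S → S e ⊗ S` that vanishes on the image of `R`, is inner on the image of `R'`, and
becomes inner after multiplication, makes homomorphisms between modules induced from `R` and `R'`
factor through copies of `S e`. -/
theorem factorsThroughCopies_of_derivation (φ : R →ₙₐ[K] S) (ψ : R' →ₙₐ[K] S)
    {M L : Type*} [AddCommGroup M] [Module K M] [Module R M] [Module.Finite R M]
    [AddCommGroup L] [Module K L] [Module R' L] [Module.Finite R' L] (e : S)
    (hφψ : φ 1 * ψ 1 = e) (hψφ : ψ 1 * φ 1 = e) (D : S →ₗ[K] S ⊗[K] S)
    (hD : ∀ x y, D (x * y) = D x * (1 ⊗ₜ y) + (x ⊗ₜ 1) * D y)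
    (hDφ : ∀ r, D (φ r) = 0)
    (hDψ : ∀ r, D (ψ r) = (ψ r ⊗ₜ 1) * (e ⊗ₜ e) - (e ⊗ₜ e) * (1 ⊗ₜ ψ r))
    (hDe : ∀ x, D x * (e ⊗ₜ 1) = D x)
    (hDμ : ∀ x, LinearMap.mul' K S (D x) = x * φ 1 - φ 1 * x) :
    (∀ f : Induced φ M →ₗ[S] Induced ψ L, FactorsThroughCopies (Submodule.span S {e}) f) ∧
    (∀ g : Induced ψ L →ₗ[S] Induced φ M, FactorsThroughCopies (Submodule.span S {e}) g) := by
  have hφ1 : φ 1 * φ 1 = φ 1 := by rw [← map_mul, one_mul]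
  have hψ1 : ψ 1 * ψ 1 = ψ 1 := by rw [← map_mul, one_mul]
  have hφe : φ 1 * e = e := by rw [← hφψ, ← mul_assoc, hφ1]
  have hψe : ψ 1 * e = e := by rw [← hψφ, ← mul_assoc, hψ1]
  have heψ : e * ψ 1 = e := by rw [← hφψ, mul_assoc, hψ1]
  have heφ : e * φ 1 = e := by rw [← hψφ, mul_assoc, hφ1]
  have he : e * e = e := by
    calc e * e = e * (φ 1 * ψ 1) := by rw [hφψ]
      _ = e := by rw [← mul_assoc, heφ, heψ]
  have hl : ∀ x y : S, ((x * y) ⊗ₜ[K] (1 : S)) = (x ⊗ₜ 1) * (y ⊗ₜ 1) := by simp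
  have hr : ∀ x y : S, ((1 : S) ⊗ₜ[K] (x * y)) = (1 ⊗ₜ x) * (1 ⊗ₜ y) := by simp
  have hc : (e ⊗ₜ[K] e) * (e ⊗ₜ 1) = e ⊗ₜ e := by simp [he]
  have hcomm : ∀ x : S, ((1 : S) ⊗ₜ[K] x) * (e ⊗ₜ 1) = (e ⊗ₜ 1) * (1 ⊗ₜ x) := by simp
  have hμ : LinearMap.mul' K S (e ⊗ₜ e) = e := by simp [he]
  constructor
  -- The map is x ↦ x(e ⊗ e) − D x. On the right, the inner part of D on R' cancels the defect of
  -- x(e ⊗ e); between φ(1) and ψ(1) its product is xe − xφ(1) + φ(1)x, whose first two terms cancel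
  -- because φ(1)ψ(1) = e.
  · refine factorsThroughCopies_of_section ψ φ L e
      (LinearMap.mulRight K (e ⊗ₜ e) ∘ₗ
        (Algebra.TensorProduct.includeLeft : S →ₐ[K] S ⊗[K] S).toLinearMap - D) ?_ ?_ ?_ ?_
    · intro r x
      change ((φ r * x) ⊗ₜ 1) * (e ⊗ₜ e) - D (φ r * x) =
        (φ r ⊗ₜ 1) * ((x ⊗ₜ 1) * (e ⊗ₜ e) - D x)
      rw [hD, hDφ, hl]
      noncomm_ring
    · intro r x
      change ((x * ψ r) ⊗ₜ 1) * (e ⊗ₜ e) - D (x * ψ r) =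
        ((x ⊗ₜ 1) * (e ⊗ₜ e) - D x) * (1 ⊗ₜ ψ r)
      rw [hD, hDψ, hl, mul_sub, sub_mul, mul_assoc, mul_assoc]
      abel
    · intro x
      change ((x ⊗ₜ 1) * (e ⊗ₜ e) - D x) * (e ⊗ₜ 1) = (x ⊗ₜ 1) * (e ⊗ₜ e) - D x
      rw [sub_mul, mul_assoc, hc, hDe]
    · intro x
      change φ 1 * LinearMap.mul' K S ((x ⊗ₜ 1) * (e ⊗ₜ e) - D x) * ψ 1 = _
      rw [map_sub, mul'_left, hμ, hDμ]
      simp only [mul_sub, sub_mul, mul_assoc, heψ, hφψ]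
      rw [← mul_assoc (φ 1) (φ 1), hφ1]
      abel
  -- The mirror image, x ↦ D x + (e ⊗ e)x: now the inner part of D on R' repairs linearity on the
  -- left.
  · refine factorsThroughCopies_of_section φ ψ M e
      (D + LinearMap.mulLeft K (e ⊗ₜ e) ∘ₗ
        (Algebra.TensorProduct.includeRight : S →ₐ[K] S ⊗[K] S).toLinearMap) ?_ ?_ ?_ ?_
    · intro r x
      change D (ψ r * x) + (e ⊗ₜ e) * (1 ⊗ₜ (ψ r * x)) =
        (ψ r ⊗ₜ 1) * (D x + (e ⊗ₜ e) * (1 ⊗ₜ x))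
      rw [hD, hDψ, hr]
      noncomm_ring
    · intro r x
      change D (x * φ r) + (e ⊗ₜ e) * (1 ⊗ₜ (x * φ r)) =
        (D x + (e ⊗ₜ e) * (1 ⊗ₜ x)) * (1 ⊗ₜ φ r)
      rw [hD, hDφ, hr]
      noncomm_ring
    · intro x
      change (D x + (e ⊗ₜ e) * (1 ⊗ₜ x)) * (e ⊗ₜ 1) = D x + (e ⊗ₜ e) * (1 ⊗ₜ x)
      rw [add_mul, mul_assoc, hcomm, ← mul_assoc, hc, hDe]
    · intro x
      change ψ 1 * LinearMap.mul' K S (D x + (e ⊗ₜ e) * (1 ⊗ₜ x)) * φ 1 = _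
      rw [map_add, mul'_right, hμ, hDμ]
      simp only [mul_add, mul_sub, sub_mul, add_mul, mul_assoc, hφ1]
      rw [← mul_assoc (ψ 1) (φ 1), hψφ, ← mul_assoc (ψ 1) e, hψe]
      abel

end TensorDerivation

/-! ### Derivations of a path algebra with prescribed values on arrows -/

section PathDerivation

universe u v w

variable {K : Type w} {V : Type u} [Field K] [Quiver.{v} V]

theorem ofPath_cons {i j k : V} (p : Quiver.Path i j) (α : j ⟶ k) :
    ofPath K ⟨i, k, p.cons α⟩ = ofArrow K α * ofPath K ⟨i, j, p⟩ := by
  rw [ofArrow, ofPath_mul_ofPath]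
  simp [mulPath]

theorem ofPath_comp {i j k : V} (p : Quiver.Path i j) (q : Quiver.Path j k) :
    ofPath K ⟨i, k, p.comp q⟩ = ofPath K ⟨j, k, q⟩ * ofPath K ⟨i, j, p⟩ := by
  rw [ofPath_mul_ofPath]
  simp [mulPath]

theorem ofPath_mul_eq_zero {i j k l : V} (p : Quiver.Path i j) (q : Quiver.Path k l) (h : j ≠ k) :
    ofPath K ⟨k, l, q⟩ * ofPath K ⟨i, j, p⟩ = 0 := by
  rw [ofPath_mul_ofPath]
  simp [mulPath, h]

theorem vertexIdem_mul_ofPath {i j : V} (p : Quiver.Path i j) :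
    vertexIdem K j * ofPath K ⟨i, j, p⟩ = ofPath K ⟨i, j, p⟩ :=
  (ofPath_comp p Quiver.Path.nil).symm

theorem ofPath_mul_vertexIdem {i j : V} (p : Quiver.Path i j) :
    ofPath K ⟨i, j, p⟩ * vertexIdem K i = ofPath K ⟨i, j, p⟩ := by
  rw [vertexIdem, ← ofPath_comp, Quiver.Path.nil_comp]

theorem vertexIdem_mul_self (i : V) : vertexIdem K i * vertexIdem K i = vertexIdem K i :=
  vertexIdem_mul_ofPath _

theorem vertexIdem_mul_of_ne {i j : V} (h : i ≠ j) : vertexIdem K j * vertexIdem K i = 0 :=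
  ofPath_mul_eq_zero _ _ h

theorem commute_vertexIdem (i j : V) : Commute (vertexIdem K i) (vertexIdem K j) := by
  by_cases h : i = j
  · rw [h]
  · rw [Commute, SemiconjBy, vertexIdem_mul_of_ne h, vertexIdem_mul_of_ne (Ne.symm h)]

variable [Fintype V] {T : Type*} [Ring T] [Algebra K T] (l r : PathAlgebra K V →ₐ[K] T)
  (δ : ∀ ⦃i j : V⦄, (i ⟶ j) → T)

/-- The values on paths of the derivation given by values on arrows. -/
def pathDer {i : V} : ∀ {j : V}, Quiver.Path i j → T
  | _, .nil => 0
  | _, .cons p α => δ α * r (ofPath K ⟨_, _, p⟩) + l (ofArrow K α) * pathDer p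

/-- The derivation of the path algebra given by values on arrows. -/
def arrowDer : PathAlgebra K V →ₗ[K] T :=
  (pathBasis K V).constr K fun p => pathDer l r δ p.path

theorem arrowDer_ofPath {i j : V} (p : Quiver.Path i j) :
    arrowDer l r δ (ofPath K ⟨i, j, p⟩) = pathDer l r δ p := by
  rw [arrowDer, ofPath, Module.Basis.constr_basis]

theorem pathDer_comp {i j k : V} (p : Quiver.Path i j) (q : Quiver.Path j k)
    (hp : l (vertexIdem K j) * pathDer l r δ p = pathDer l r δ p) :
    pathDer l r δ (p.comp q) =
      pathDer l r δ q * r (ofPath K ⟨i, j, p⟩) + l (ofPath K ⟨j, k, q⟩) * pathDer l r δ p := by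
  induction q with
  | nil =>
    rw [Quiver.Path.comp_nil, pathDer, zero_mul, zero_add]
    exact hp.symm
  | cons q α ih =>
    rw [Quiver.Path.comp_cons, pathDer, pathDer, ih, ofPath_comp, ofPath_cons, map_mul, map_mul]
    noncomm_ring

theorem vertexIdem_mul_pathDer
    (hl : ∀ ⦃i j : V⦄ (α : i ⟶ j), l (vertexIdem K j) * δ α = δ α)
    {i j : V} (p : Quiver.Path i j) :
    l (vertexIdem K j) * pathDer l r δ p = pathDer l r δ p := by
  cases p with
  | nil => rw [pathDer, mul_zero]
  | cons p α =>
    rw [pathDer, mul_add, ← mul_assoc, hl, ← mul_assoc, ← map_mul, ofArrow, vertexIdem_mul_ofPath]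

/-- No condition on δ is needed here: the recursion ends at the trivial path, where δ α is
multiplied by r(e_i). -/
theorem pathDer_mul_vertexIdem {i j : V} (p : Quiver.Path i j) :
    pathDer l r δ p * r (vertexIdem K i) = pathDer l r δ p := by
  induction p with
  | nil => rw [pathDer, zero_mul]
  | cons p α ih =>
    rw [pathDer, add_mul, mul_assoc, mul_assoc, ih, ← map_mul, ofPath_mul_vertexIdem]

theorem arrowDer_mul
    (hl : ∀ ⦃i j : V⦄ (α : i ⟶ j), l (vertexIdem K j) * δ α = δ α)
    (x y : PathAlgebra K V) :
    arrowDer l r δ (x * y) = arrowDer l r δ x * r y + l x * arrowDer l r δ y := by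
  induction x using induction_ofPath with
  | h0 => simp
  | hadd x x' hx hx' => simp only [add_mul, map_add, hx, hx']; abel
  | hsmul c q =>
    induction y using induction_ofPath with
    | h0 => simp
    | hadd y y' hy hy' => simp only [mul_add, map_add, hy, hy']; abel
    | hsmul d p =>
      obtain ⟨i, j, p⟩ := p
      obtain ⟨k, m, q⟩ := q
      suffices h : arrowDer l r δ (ofPath K ⟨k, m, q⟩ * ofPath K ⟨i, j, p⟩) =
          arrowDer l r δ (ofPath K ⟨k, m, q⟩) * r (ofPath K ⟨i, j, p⟩) +
            l (ofPath K ⟨k, m, q⟩) * arrowDer l r δ (ofPath K ⟨i, j, p⟩) by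
        simp only [smul_mul_assoc, mul_smul_comm, map_smul, h, smul_add]
      by_cases h : j = k
      · subst h
        rw [← ofPath_comp, arrowDer_ofPath, arrowDer_ofPath, arrowDer_ofPath,
          pathDer_comp _ _ _ _ _ (vertexIdem_mul_pathDer l r δ hl p)]
      -- For paths that do not compose, both Leibniz terms must vanish: inserting the end
      -- idempotents of the two derivatives produces zero products of paths.
      · rw [ofPath_mul_eq_zero _ _ h, map_zero, arrowDer_ofPath, arrowDer_ofPath,
          ← pathDer_mul_vertexIdem l r δ q, ← vertexIdem_mul_pathDer l r δ hl p,
          mul_assoc, ← map_mul, ← mul_assoc (l _), ← map_mul, vertexIdem, vertexIdem,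
          ofPath_mul_eq_zero _ _ h, ofPath_mul_eq_zero _ _ h]
        simp

theorem arrowDer_mul_right (z : T) (hz : ∀ x, Commute (r x) z)
    (hδ : ∀ ⦃i j : V⦄ (α : i ⟶ j), δ α * z = δ α) (x : PathAlgebra K V) :
    arrowDer l r δ x * z = arrowDer l r δ x := by
  induction x using induction_ofPath with
  | h0 => simp
  | hadd x x' hx hx' => simp only [add_mul, map_add, hx, hx']
  | hsmul c q =>
    obtain ⟨i, j, q⟩ := q
    rw [map_smul, smul_mul_assoc, arrowDer_ofPath]
    congr 1
    induction q with
    | nil => rw [pathDer, zero_mul]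
    | cons p α ih => rw [pathDer, add_mul, mul_assoc, (hz _).eq, ← mul_assoc, hδ, mul_assoc, ih]

end PathDerivation

/-! ### Passage to KQ/I -/

section QuotientAlgebra

universe u v w

variable {K : Type w} {V : Type u} [Field K] [Quiver.{v} V] [Fintype V]

/-- The projection of the path algebra to `KQ/I`. -/
def quotHom (I : TwoSidedIdeal (PathAlgebra K V)) : PathAlgebra K V →ₐ[K] QuotAlg I where
  toFun := quotMk I
  map_one' := rfl
  map_mul' _ _ := rfl
  map_zero' := rfl
  map_add' _ _ := rfl
  commutes' _ := rfl

theorem quotHom_surjective (I : TwoSidedIdeal (PathAlgebra K V)) :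
    Function.Surjective (quotHom I) := Quotient.mk_surjective

theorem quotHom_eq_zero {I : TwoSidedIdeal (PathAlgebra K V)} {x : PathAlgebra K V} (hx : x ∈ I) :
    quotHom I x = 0 :=
  Quotient.sound (by
    change I.ringCon x 0
    rwa [TwoSidedIdeal.rel_iff, sub_zero])

/-- The linear map on `KQ/I` induced by a linear map that vanishes on `I`. -/
def quotLift (I : TwoSidedIdeal (PathAlgebra K V)) {N : Type*} [AddCommGroup N] [Module K N]
    (F : PathAlgebra K V →ₗ[K] N) (hF : ∀ x ∈ I, F x = 0) : QuotAlg I →ₗ[K] N where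
  toFun := Quotient.lift F (by
    intro x y hxy
    have h1 : x - y ∈ I := (TwoSidedIdeal.rel_iff I x y).1 hxy
    have h2 := hF _ h1
    rwa [map_sub, sub_eq_zero] at h2)
  map_add' x y := by
    induction x using Quotient.inductionOn with
    | h x =>
      induction y using Quotient.inductionOn with
      | h y => exact map_add F x y
  map_smul' c x := by
    induction x using Quotient.inductionOn with
    | h x => exact map_smul F c x

end QuotientAlgebra

/-! ### The derivation of the glued path algebra -/

section GluedQuiver

variable {VA VB : Type*} (a : VA) (b : VB)

theorem GlueVertex.inA_eq_inB_iff {i : VA} {j : VB} :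
    GlueVertex.inA a b i = GlueVertex.inB a b j ↔ i = a ∧ j = b := by
  classical
  constructor
  · intro h
    let f : GlueVertex a b → VA ⊕ VB :=
      Quot.lift (Sum.elim (fun i => if i = a then Sum.inr b else Sum.inl i) Sum.inr) (by
        rintro _ _ ⟨rfl, rfl⟩
        simp)
    have h1 : (if i = a then Sum.inr b else Sum.inl i : VA ⊕ VB) = Sum.inr j := congrArg f h
    split_ifs at h1 with hi
    exact ⟨hi, (Sum.inr_injective h1).symm⟩
  · rintro ⟨rfl, rfl⟩
    exact GlueVertex.inA_eq_inB _ _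

variable [Quiver VA] [Quiver VB] {K : Type*} [Field K]

theorem pathMap_vertexIdem {V W : Type*} [Quiver V] [Quiver W] (F : V ⥤q W) (i : V) :
    pathMap K F (vertexIdem K i) = vertexIdem K (F.obj i) :=
  pathMap_ofPath F _

theorem pathMap_ofArrow {V W : Type*} [Quiver V] [Quiver W] (F : V ⥤q W) {i j : V} (α : i ⟶ j) :
    pathMap K F (ofArrow K α) = ofArrow K (F.map α) :=
  pathMap_ofPath F _

variable [Fintype VA] [Fintype VB]

theorem pathMap_one {V W : Type*} [Quiver V] [Fintype V] [Quiver W] (F : V ⥤q W) :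
    pathMap K F 1 = ∑ i, vertexIdem K (F.obj i) := by
  rw [one_def, map_sum]
  exact Finset.sum_congr rfl fun i _ => pathMap_vertexIdem F i

theorem commute_vertexIdem_pathMap_one {V W : Type*} [Quiver V] [Fintype V] [Quiver W] [Fintype W]
    (F : V ⥤q W) (k : W) : Commute (vertexIdem K k) (pathMap K F 1) := by
  rw [pathMap_one]
  exact Commute.sum_right _ _ _ fun i _ => commute_vertexIdem _ _

/-- The two vertex sets meet in the glued vertex alone, so orthogonality of the idempotents leaves
one term. -/
theorem pathMap_one_mul_pathMap_one :
    pathMap K (inclA a b) 1 * pathMap K (inclB a b) 1 = vertexIdem K (GlueVertex.glued a b) := by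
  rw [pathMap_one, pathMap_one, Finset.sum_mul_sum, Finset.sum_eq_single a, Finset.sum_eq_single b]
  · change vertexIdem K (GlueVertex.inA a b a) * vertexIdem K (GlueVertex.inB a b b) = _
    rw [← GlueVertex.inA_eq_inB, vertexIdem_mul_self]
    rfl
  · intro j _ hj
    exact vertexIdem_mul_of_ne fun h => hj ((GlueVertex.inA_eq_inB_iff a b).1 h.symm).2
  · simp
  · intro i _ hi
    exact Finset.sum_eq_zero fun j _ =>
      vertexIdem_mul_of_ne fun h => hi ((GlueVertex.inA_eq_inB_iff a b).1 h.symm).1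
  · simp

theorem pathMap_one_mul_pathMap_one' :
    pathMap K (inclB a b) 1 * pathMap K (inclA a b) 1 = vertexIdem K (GlueVertex.glued a b) := by
  rw [← pathMap_one_mul_pathMap_one, pathMap_one (inclB a b)]
  exact Commute.sum_left _ _ _ fun i _ => commute_vertexIdem_pathMap_one (inclA a b) _

variable {T : Type*} [Ring T] [Algebra K T] (l r : PathAlgebra K (GlueVertex a b) →ₐ[K] T) (c : T)

/-- The values on arrows of the derivation that is zero on the first quiver and the commutator
with `c` on the second one. -/
def glueArrowDer : ∀ ⦃i j : GlueVertex a b⦄, (i ⟶ j) → T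
  | _, _, .left _ => 0
  | _, _, .right β => l (ofArrow K ((inclB a b).map β)) * c - c * r (ofArrow K ((inclB a b).map β))

/-- The derivation that is zero on the first quiver and the commutator with `c` on the second. -/
abbrev glueDer : PathAlgebra K (GlueVertex a b) →ₗ[K] T :=
  arrowDer l r (glueArrowDer a b l r c)

/-- `hc` says that the commutator with c vanishes on vertices; it also lets the target idempotent of
an arrow pass across c. -/
theorem glueDer_mul (hc : ∀ k, l (vertexIdem K k) * c = c * r (vertexIdem K k))
    (x y : PathAlgebra K (GlueVertex a b)) :
    glueDer a b l r c (x * y) = glueDer a b l r c x * r y + l x * glueDer a b l r c y := by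
  refine arrowDer_mul l r _ ?_ x y
  rintro _ _ (α | β)
  · exact mul_zero _
  · change l (vertexIdem K ((inclB a b).obj _)) * (l (ofArrow K _) * c - c * r (ofArrow K _)) =
      l (ofArrow K _) * c - c * r _
    rw [mul_sub, ← mul_assoc, ← mul_assoc, hc, mul_assoc c, ← map_mul, ← map_mul, ofArrow,
      vertexIdem_mul_ofPath]

theorem glueDer_pathMap_inclA (x : PathAlgebra K VA) :
    glueDer a b l r c (pathMap K (inclA a b) x) = 0 := by
  induction x using induction_ofPath with
  | h0 => simp
  | hadd x y hx hy => rw [map_add, map_add, hx, hy, add_zero]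
  | hsmul d p =>
    obtain ⟨i, j, p⟩ := p
    rw [map_smul, map_smul, pathMap_ofPath, AnyPath.map, arrowDer_ofPath]
    suffices h : pathDer l r (glueArrowDer a b l r c) ((inclA a b).mapPath p) = 0 by
      dsimp only
      rw [h, smul_zero]
    induction p with
    | nil => rfl
    | cons p α ih =>
      rw [Prefunctor.mapPath_cons, pathDer, ih, mul_zero, add_zero]
      exact zero_mul _

theorem glueDer_pathMap_inclB (hc : ∀ k, l (vertexIdem K k) * c = c * r (vertexIdem K k))
    (x : PathAlgebra K VB) :
    glueDer a b l r c (pathMap K (inclB a b) x) =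
      l (pathMap K (inclB a b) x) * c - c * r (pathMap K (inclB a b) x) := by
  induction x using induction_ofPath with
  | h0 => simp
  | hadd x y hx hy => simp only [map_add, hx, hy, add_mul, mul_add]; abel
  | hsmul d p =>
    obtain ⟨i, j, p⟩ := p
    suffices h : pathDer l r (glueArrowDer a b l r c) ((inclB a b).mapPath p) =
        l (ofPath K ⟨_, _, (inclB a b).mapPath p⟩) * c -
          c * r (ofPath K ⟨_, _, (inclB a b).mapPath p⟩) by
      simp only [map_smul, pathMap_ofPath, AnyPath.map, arrowDer_ofPath, smul_mul_assoc,
        mul_smul_comm, ← smul_sub]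
      rw [h]
    induction p with
    | nil =>
      change (0 : T) = l (vertexIdem K _) * c - c * r (vertexIdem K _)
      rw [hc, sub_self]
    | cons p β ih =>
      rw [Prefunctor.mapPath_cons, pathDer, ih, ofPath_cons, map_mul, map_mul]
      change (l (ofArrow K _) * c - c * r (ofArrow K _)) * _ + _ = _
      noncomm_ring

theorem glueDer_mul_right (z : T) (hz : ∀ x, Commute (r x) z) (hcz : c * z = c)
    (x : PathAlgebra K (GlueVertex a b)) : glueDer a b l r c x * z = glueDer a b l r c x := by
  refine arrowDer_mul_right l r _ z hz ?_ x
  rintro _ _ (α | β)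
  · exact zero_mul _
  · change (l (ofArrow K _) * c - c * r (ofArrow K _)) * z = l (ofArrow K _) * c - c * r _
    rw [sub_mul, mul_assoc, mul_assoc, (hz _).eq, ← mul_assoc c, hcz]

/-- On generators from I_B the value is a commutator with c, zero because both actions kill the
ideal; the same vanishing and the Leibniz rule extend this to multiples. -/
theorem glueDer_eq_zero_of_mem (IA : TwoSidedIdeal (PathAlgebra K VA))
    (IB : TwoSidedIdeal (PathAlgebra K VB))
    (hc : ∀ k, l (vertexIdem K k) * c = c * r (vertexIdem K k))
    (hl : ∀ x ∈ glueIdeal a b IA IB, l x = 0) (hr : ∀ x ∈ glueIdeal a b IA IB, r x = 0)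
    {x : PathAlgebra K (GlueVertex a b)} (hx : x ∈ glueIdeal a b IA IB) :
    glueDer a b l r c x = 0 := by
  induction hx using TwoSidedIdeal.span_induction with
  | mem x hx =>
    have hlx := hl x (TwoSidedIdeal.subset_span hx)
    have hrx := hr x (TwoSidedIdeal.subset_span hx)
    obtain ⟨x, -, rfl⟩ | ⟨x, -, rfl⟩ := hx
    · exact glueDer_pathMap_inclA a b l r c x
    · rw [glueDer_pathMap_inclB a b l r c hc, hlx, hrx, zero_mul, mul_zero, sub_zero]
  | zero => rw [map_zero]
  | add x y _ _ hx hy => rw [map_add, hx, hy, add_zero]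
  | neg x _ hx => rw [map_neg, hx, neg_zero]
  | left_absorb y x hx h => rw [glueDer_mul a b l r c hc, h, hr x hx, mul_zero, mul_zero, add_zero]
  | right_absorb y x hx h => rw [glueDer_mul a b l r c hc, h, hl x hx, zero_mul, zero_mul, add_zero]

/-- Both sides are derivations that vanish on vertices, so it suffices to compare them on arrows. -/
theorem mul'_glueDer {S : Type*} [Ring S] [Algebra K S]
    (π : PathAlgebra K (GlueVertex a b) →ₐ[K] S) (e : S)
    (he : e = π (vertexIdem K (GlueVertex.glued a b)))
    (x : PathAlgebra K (GlueVertex a b)) :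
    LinearMap.mul' K S (glueDer a b (Algebra.TensorProduct.includeLeft.comp π)
      (Algebra.TensorProduct.includeRight.comp π) (e ⊗ₜ[K] e) x) =
      π x * π (pathMap K (inclA a b) 1) - π (pathMap K (inclA a b) 1) * π x := by
  have hee : e * e = e := by rw [he, ← map_mul, vertexIdem_mul_self]
  have hμ : LinearMap.mul' K S (e ⊗ₜ e) = e := by simp [hee]
  induction x using induction_ofPath with
  | h0 => simp
  | hadd x y hx hy => simp only [map_add, hx, hy, add_mul, mul_add]; abel
  | hsmul d p =>
    obtain ⟨i, j, p⟩ := p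
    simp only [map_smul, arrowDer_ofPath, smul_mul_assoc, mul_smul_comm, ← smul_sub]
    congr 1
    induction p with
    | nil =>
      change LinearMap.mul' K S 0 = π (vertexIdem K i) * _ - _ * π (vertexIdem K i)
      rw [map_zero, ← map_mul, ← map_mul, (commute_vertexIdem_pathMap_one _ _).eq, sub_self]
    | cons p α ih =>
      rw [pathDer, map_add]
      change LinearMap.mul' K S (_ * ((1 : S) ⊗ₜ π _)) +
        LinearMap.mul' K S ((π _ ⊗ₜ (1 : S)) * _) = _
      rw [mul'_left, mul'_right, ih, ofPath_cons, map_mul]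
      suffices h : LinearMap.mul' K S (glueArrowDer a b (Algebra.TensorProduct.includeLeft.comp π)
          (Algebra.TensorProduct.includeRight.comp π) (e ⊗ₜ[K] e) α) =
          π (ofArrow K α) * π (pathMap K (inclA a b) 1) -
            π (pathMap K (inclA a b) 1) * π (ofArrow K α) by
        rw [h]
        noncomm_ring
      -- An arrow of the first quiver commutes with e_A. For β in the second, β = βe_B = e_Bβ gives
      -- βe_A = βe and e_Aβ = eβ.
      obtain α | β := α
      · change LinearMap.mul' K S 0 = π (ofArrow K ((inclA a b).map α)) * _ -
          _ * π (ofArrow K ((inclA a b).map α))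
        rw [← pathMap_ofArrow, ← map_mul π, ← map_mul π,
          ← pathMap_mul (inclA a b) (GlueVertex.inA_injective a b),
          ← pathMap_mul (inclA a b) (GlueVertex.inA_injective a b), mul_one, one_mul, map_zero,
          sub_self]
      · change LinearMap.mul' K S ((π (ofArrow K ((inclB a b).map β)) ⊗ₜ (1 : S)) * (e ⊗ₜ e) -
          (e ⊗ₜ e) * ((1 : S) ⊗ₜ π (ofArrow K ((inclB a b).map β)))) =
            π (ofArrow K ((inclB a b).map β)) * _ - _ * π (ofArrow K ((inclB a b).map β))
        rw [map_sub, mul'_left, mul'_right, hμ, he, ← map_mul, ← map_mul, ← map_mul, ← map_mul,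
          ← pathMap_ofArrow]
        congr 2
        · rw [← pathMap_one_mul_pathMap_one', ← mul_assoc,
            ← pathMap_mul _ (GlueVertex.inB_injective a b), mul_one]
        · rw [← pathMap_one_mul_pathMap_one, mul_assoc,
            ← pathMap_mul _ (GlueVertex.inB_injective a b), one_mul]

end GluedQuiver

end SimpleGluing

/-! ### Descent of the derivation to Λ and conclusion -/

open SimpleGluing in
/-- Homomorphisms between modules induced from the two sides of a simple gluing factor through
copies of the projective module of the glued vertex. -/
theorem SimpleGluing.factorsThroughCopies_gluedProj {K : Type*} [Field K]
    {VA VB : Type*} [Fintype VA] [Fintype VB] [Quiver VA] [Quiver VB] (a : VA) (b : VB)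
    (IA : TwoSidedIdeal (PathAlgebra K VA)) (IB : TwoSidedIdeal (PathAlgebra K VB))
    (X Y : Type*) [AddCommGroup X] [AddCommGroup Y] [Module K X] [Module K Y]
    [Module (QuotAlg IA) X] [Module (QuotAlg IB) Y]
    [Module.Finite (QuotAlg IA) X] [Module.Finite (QuotAlg IB) Y] :
    (∀ f : Induced (mapA a b IA IB) X →ₗ[GlueAlg a b IA IB] Induced (mapB a b IA IB) Y,
      FactorsThroughCopies (gluedProj a b IA IB) f) ∧
    (∀ g : Induced (mapB a b IA IB) Y →ₗ[GlueAlg a b IA IB] Induced (mapA a b IA IB) X,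
      FactorsThroughCopies (gluedProj a b IA IB) g) := by
  let J := glueIdeal a b IA IB
  let π := quotHom J
  let e : GlueAlg a b IA IB := π (vertexIdem K (GlueVertex.glued a b))
  let l : PathAlgebra K (GlueVertex a b) →ₐ[K] GlueAlg a b IA IB ⊗[K] GlueAlg a b IA IB :=
    Algebra.TensorProduct.includeLeft.comp π
  let r : PathAlgebra K (GlueVertex a b) →ₐ[K] GlueAlg a b IA IB ⊗[K] GlueAlg a b IA IB :=
    Algebra.TensorProduct.includeRight.comp π
  have hee : e * e = e := by
    change π _ * π _ = π _
    rw [← map_mul, vertexIdem_mul_self]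
  have hc : ∀ k, l (vertexIdem K k) * (e ⊗ₜ e) = (e ⊗ₜ e) * r (vertexIdem K k) := by
    intro k
    change (π (vertexIdem K k) ⊗ₜ 1) * (e ⊗ₜ e) = (e ⊗ₜ e) * (1 ⊗ₜ π (vertexIdem K k))
    rw [Algebra.TensorProduct.tmul_mul_tmul, Algebra.TensorProduct.tmul_mul_tmul, one_mul, mul_one]
    change (π _ * π _) ⊗ₜ π _ = π _ ⊗ₜ[K] (π _ * π _)
    rw [← map_mul, ← map_mul]
    -- Both sides are e ⊗ e at the glued vertex and 0 at every other vertex.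
    by_cases hk : k = GlueVertex.glued a b
    · rw [hk, vertexIdem_mul_self]
    · rw [vertexIdem_mul_of_ne hk, vertexIdem_mul_of_ne (Ne.symm hk), map_zero,
        TensorProduct.zero_tmul, TensorProduct.tmul_zero]
  let D : GlueAlg a b IA IB →ₗ[K] GlueAlg a b IA IB ⊗[K] GlueAlg a b IA IB :=
    quotLift J (glueDer a b l r (e ⊗ₜ e)) fun x hx =>
      glueDer_eq_zero_of_mem a b l r _ IA IB hc
        (fun y hy => by
          change π y ⊗ₜ 1 = 0
          rw [quotHom_eq_zero hy, TensorProduct.zero_tmul])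
        (fun y hy => by
          change 1 ⊗ₜ π y = 0
          rw [quotHom_eq_zero hy, TensorProduct.tmul_zero]) hx
  refine factorsThroughCopies_of_derivation (mapA a b IA IB) (mapB a b IA IB) e
    (congrArg π (pathMap_one_mul_pathMap_one a b)) (congrArg π (pathMap_one_mul_pathMap_one' a b))
    D ?_ ?_ ?_ ?_ ?_
  · intro x y
    obtain ⟨x, rfl⟩ := quotHom_surjective J x
    obtain ⟨y, rfl⟩ := quotHom_surjective J y
    exact glueDer_mul a b l r _ hc x y
  · intro x
    obtain ⟨x, rfl⟩ := quotHom_surjective IA x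
    exact glueDer_pathMap_inclA a b l r _ x
  · intro x
    obtain ⟨x, rfl⟩ := quotHom_surjective IB x
    exact glueDer_pathMap_inclB a b l r _ hc x
  · intro x
    obtain ⟨x, rfl⟩ := quotHom_surjective J x
    refine glueDer_mul_right a b l r _ (e ⊗ₜ 1) (fun y => ?_) ?_ x
    · change (1 ⊗ₜ π y) * (e ⊗ₜ 1) = (e ⊗ₜ 1) * (1 ⊗ₜ π y)
      simp
    · simp [hee]
  · intro x
    obtain ⟨x, rfl⟩ := quotHom_surjective J x
    exact mul'_glueDer a b π e rfl x

end

theorem corollary3p17 {K : Type*} [Field K] [IsAlgClosed K]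
    {VA VB : Type*} [Fintype VA] [Fintype VB] [Quiver VA] [Quiver VB]
    [∀ i j : VA, Finite (i ⟶ j)] [∀ i j : VB, Finite (i ⟶ j)]
    (a : VA) (b : VB)
    (IA : TwoSidedIdeal (SimpleGluing.PathAlgebra K VA))
    (IB : TwoSidedIdeal (SimpleGluing.PathAlgebra K VB))
    (hIA : SimpleGluing.IsAdmissible IA) (hIB : SimpleGluing.IsAdmissible IB)
    (hfin : Module.Finite K (SimpleGluing.GlueAlg a b IA IB))
    (X Y : Type*) [AddCommGroup X] [AddCommGroup Y] [Module K X] [Module K Y]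
    [Module (SimpleGluing.QuotAlg IA) X] [IsScalarTower K (SimpleGluing.QuotAlg IA) X]
    [Module (SimpleGluing.QuotAlg IB) Y] [IsScalarTower K (SimpleGluing.QuotAlg IB) Y]
    (hX : SimpleGluing.IsGorensteinProjective (SimpleGluing.QuotAlg IA) X)
    (hY : SimpleGluing.IsGorensteinProjective (SimpleGluing.QuotAlg IB) Y) :
    (∀ f : SimpleGluing.Induced (SimpleGluing.mapA a b IA IB) X
        →ₗ[SimpleGluing.GlueAlg a b IA IB] SimpleGluing.Induced (SimpleGluing.mapB a b IA IB) Y,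
      SimpleGluing.FactorsThroughCopies (SimpleGluing.gluedProj a b IA IB) f) ∧
    (∀ g : SimpleGluing.Induced (SimpleGluing.mapB a b IA IB) Y
        →ₗ[SimpleGluing.GlueAlg a b IA IB] SimpleGluing.Induced (SimpleGluing.mapA a b IA IB) X,
      SimpleGluing.FactorsThroughCopies (SimpleGluing.gluedProj a b IA IB) g) := by
  have := hX.finite
  have := hY.finite
  exact SimpleGluing.factorsThroughCopies_gluedProj a b IA IB X Y
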